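/- Simplicial complexes are finite and contain the empty simplex (of dimension $-1$). For a complex $X$ and $k\ge -1$ let $X(k)$ be the set of its $k$-dimensional simplices (those with $k+1$ vertices), let $C^k(X)$ be the space of real $k$-cochains with the inner product $\langle\phi,\psi\rangle=\sum_{\sigma\in X(k)}\phi(\sigma)\psi(\sigma)$, let $d_k:C^k(X)\to C^{k+1}(X)$ be the coboundary operator, with $C^{-2}(X)=0$, and let $\mu_k(X)$ be the smallest eigenvalue of the reduced Laplacian $L_k=d_{k-1}d_{k-1}^*+d_k^*d_k$ on $C^k(X)$. Let $\delta_k(X)$ be the minimum over $\sigma\in X(k)$ of the number of $\eta\in X(k+1)$ with $\sigma\subset\eta$. A missing face of $X$ is a set of vertices that is not a simplex of $X$ although all its proper subsets are. Let $d\ge 1$ and $t,r\ge 0$ be integers and let $Z=\bigl(\Delta_d^{(d-1)}\bigr)^{*t}*\Delta_{r-1}$, where $\Delta_m$ is the complete complex on $m+1$ vertices (so $\Delta_{-1}=\{\emptyset\}$), $\Delta_d^{(d-1)}$ is the $(d-1)$-dimensional skeleton of $\Delta_d$, $*$ is the join of complexes on disjoint vertex sets and $X^{*t}$ is the join of $t$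 disjoint copies of $X$ (with $X^{*0}=\{\emptyset\}$). Let $n=(d+1)t+r$. Then $Z$ has $n$ vertices, $\dim Z=dt+r-1$, and all missing faces of $Z$ have dimension $d$; if $t\ge1$, there is one, so the maximal dimension of a missing face of $Z$ is $d$. Moreover \[ \mu_k(Z)=\begin{cases}(d+1)\left(t-\left\lfloor\frac{k+1}{d}\right\rfloor\right)+r & \text{if } -1\le k\le dt-1,\\ r & \text{if } dt\le k\le dt+r-1,\end{cases} \] and \[ \delta_k(Z)=\begin{cases}n-(k+1)-\left\lfloor\frac{k+1}{d}\right\rfloor & \text{if } -1\le k\le dt-1,\\ n-(k+1)-t & \text{if } dt\le k\le dt+r-1.\end{cases} \] In particular, $\mu_k(Z)=(d+1)(\delta_k(Z)+k+1)-dn$ for all $-1\le k\le\dim Z$. That is, $Z$ attains equality, in every such dimension $k$, in the inequality $\mu_k(X)\ge(d+1)(\delta_k(X)+k+1)-dn$, which the paper considers for complexes $X$ on $n$ vertices without missing faces of dimension larger than $d$. -/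

import Mathlib

open Module

/-- A simplicial complex on the vertex set `V`: a family of finite subsets of `V` that is closed
under taking subsets. The empty simplex, of dimension `-1`, always belongs to it (Mathlib's
`PreAbstractSimplicialComplex` leaves the empty simplex out, so that reduced cochains in
dimension `-1` and joins cannot be written down with it directly). -/
structure FaceComplex (V : Type*) where
  /-- the simplices of the complex -/
  faces : Set (Finset V)
  /-- the empty simplex belongs to the complex -/
  empty_mem : ∅ ∈ faces
  /-- subsets of simplices are simplices -/
  down_closed : ∀ σ ∈ faces, ∀ τ ⊆ σ, τ ∈ faces

/-- The dimension of a finite set of vertices, `|σ| - 1`. -/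
def faceDim {V : Type*} (σ : Finset V) : ℤ := (σ.card : ℤ) - 1

namespace FaceComplex

section Constructions

variable {V W : Type*}

/-- The complete simplicial complex on the vertex set `V`; for `V = Fin (m + 1)` it is the simplex
`Δ_m`, and for `V = Fin 0` it is `Δ_{-1} = {∅}`. -/
def complete (V : Type*) : FaceComplex V where
  faces := Set.univ
  empty_mem := Set.mem_univ _
  down_closed := fun _ _ _ _ => Set.mem_univ _

/-- The `k`-dimensional skeleton: all simplices with at most `k + 1` vertices. -/
def skeleton (X : FaceComplex V) (k : ℕ) : FaceComplex V where
  faces := {σ | σ ∈ X.faces ∧ σ.card ≤ k + 1}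
  empty_mem := ⟨X.empty_mem, by simp⟩
  down_closed := fun σ hσ τ hτ =>
    ⟨X.down_closed σ hσ.1 τ hτ, (Finset.card_le_card hτ).trans hσ.2⟩

/-- The join `X * Y`, on the disjoint union of the two vertex sets: its simplices are the disjoint
unions of a simplex of `X` and a simplex of `Y`. -/
def join (X : FaceComplex V) (Y : FaceComplex W) : FaceComplex (V ⊕ W) where
  faces := {ρ | ∃ σ ∈ X.faces, ∃ τ ∈ Y.faces, ρ = σ.disjSum τ}
  empty_mem := ⟨∅, X.empty_mem, ∅, Y.empty_mem, rfl⟩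
  down_closed := by
    rintro _ ⟨σ, hσ, τ, hτ, rfl⟩ ρ hρ
    refine ⟨ρ.toLeft, X.down_closed σ hσ _ fun v hv => ?_,
      ρ.toRight, Y.down_closed τ hτ _ fun w hw => ?_, (Finset.toLeft_disjSum_toRight).symm⟩
    · exact Finset.inl_mem_disjSum.1 (hρ (Finset.mem_toLeft.1 hv))
    · exact Finset.inr_mem_disjSum.1 (hρ (Finset.mem_toRight.1 hw))

/-- The `t`-fold join `X * ⋯ * X` of disjoint copies of `X`, the `i`-th copy having the vertex set
`{i} × V`: its simplices are the disjoint unions of one simplex from each copy. -/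
def joinPow (X : FaceComplex V) (t : ℕ) : FaceComplex (Fin t × V) where
  faces := {ρ | ∃ s : Fin t → Finset V, (∀ i, s i ∈ X.faces) ∧ ∀ i v, (i, v) ∈ ρ ↔ v ∈ s i}
  empty_mem := ⟨fun _ => ∅, fun _ => X.empty_mem, by simp⟩
  down_closed := by
    classical
    rintro ρ ⟨s, hs, hρ⟩ η hη
    refine ⟨fun i => (s i).filter fun v => (i, v) ∈ η, fun i => ?_, fun i v => ?_⟩
    · exact X.down_closed (s i) (hs i) _ (Finset.filter_subset _ _)
    · rw [Finset.mem_filter]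
      exact ⟨fun h => ⟨(hρ i v).1 (hη h), h⟩, fun h => h.2⟩

/-- The copy of a complex obtained by renaming its vertices along a bijection. -/
def relabel (X : FaceComplex V) (e : V ≃ W) : FaceComplex W where
  faces := {ρ | ∃ σ ∈ X.faces, ρ = σ.map e.toEmbedding}
  empty_mem := ⟨∅, X.empty_mem, by simp⟩
  down_closed := by
    rintro _ ⟨σ, hσ, rfl⟩ τ hτ
    obtain ⟨u, hu, rfl⟩ := Finset.subset_map_iff.1 hτ
    exact ⟨u, X.down_closed σ hσ u hu, rfl⟩

/-- A missing face: a set of vertices that is not a simplex, although all its proper subsets are. -/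
def IsMissingFace (X : FaceComplex V) (σ : Finset V) : Prop :=
  σ ∉ X.faces ∧ ∀ τ, τ ⊂ σ → τ ∈ X.faces

end Constructions

section Degrees

variable {V : Type*} [Fintype V]

open Classical in
/-- `X(k)`, the set of `k`-dimensional simplices of `X`. -/
noncomputable def simplices (X : FaceComplex V) (k : ℤ) : Finset (Finset V) :=
  Finset.univ.filter fun σ => σ ∈ X.faces ∧ faceDim σ = k

open Classical in
/-- The degree of a simplex: the number of simplices of one dimension more that contain it. -/
noncomputable def degree (X : FaceComplex V) (σ : Finset V) : ℕ :=
  ((X.simplices (faceDim σ + 1)).filter fun η => σ ⊆ η).card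

/-- The set of degrees of the `k`-dimensional simplices of `X`. -/
def degreeSet (X : FaceComplex V) (k : ℤ) : Set ℕ :=
  {m | ∃ σ ∈ X.simplices k, m = X.degree σ}

/-- `δ_k(X)`, the minimal degree of a `k`-dimensional simplex (a genuine minimum as soon as `X` has
a `k`-dimensional simplex). -/
noncomputable def minDegree (X : FaceComplex V) (k : ℤ) : ℕ := sInf (X.degreeSet k)

end Degrees

section Laplacian

variable {V : Type*} [Fintype V] [LinearOrder V]

/-- For `τ ⊆ σ`, with the vertices listed increasingly: the sign of the permutation that takes the
list of `σ` to the list of `σ \ τ` followed by the list of `τ`, computed by counting its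
inversions. -/
def sgn (σ τ : Finset V) : ℝ :=
  (-1) ^ (((σ \ τ) ×ˢ τ).filter fun p => p.2 < p.1).card

/-- The real `k`-cochains `C^k(X)` with their inner product `∑_{σ ∈ X(k)} φ(σ) ψ(σ)`: a
skew-symmetric function on the ordered `k`-simplices is given by its values on the increasingly
ordered ones. There are no simplices of dimension less than `-1`, so `C^k(X) = 0` for `k < -1`. -/
abbrev Cochains (X : FaceComplex V) (k : ℤ) : Type _ := EuclideanSpace ℝ (X.simplices k)

/-- The coboundary operator from `j`-cochains to `k`-cochains, where `k = j + 1`: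
`(d φ)(σ) = ∑_τ sgn(σ, τ) φ(τ)`, the sum over the `j`-dimensional faces `τ` of `σ`. -/
noncomputable def coboundary (X : FaceComplex V) (j k : ℤ) (_h : k = j + 1) :
    X.Cochains j →ₗ[ℝ] X.Cochains k where
  toFun φ := WithLp.toLp 2 fun σ =>
    ∑ τ : X.simplices j, if τ.1 ⊆ σ.1 then sgn σ.1 τ.1 * φ τ else 0
  map_add' φ ψ := by
    ext σ
    simp only [PiLp.add_apply]
    rw [← Finset.sum_add_distrib]
    refine Finset.sum_congr rfl fun τ _ => ?_
    split_ifs <;> ring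
  map_smul' c φ := by
    ext σ
    simp only [PiLp.smul_apply, smul_eq_mul, RingHom.id_apply]
    rw [Finset.mul_sum]
    refine Finset.sum_congr rfl fun τ _ => ?_
    split_ifs <;> ring

/-- The reduced `k`-Laplacian `d_{k-1} d_{k-1}^* + d_k^* d_k`; for `k = -1` the first term vanishes
because `C^{-2}(X) = 0`. -/
noncomputable def laplacian (X : FaceComplex V) (k : ℤ) : End ℝ (X.Cochains k) :=
  X.coboundary (k - 1) k (by ring) ∘ₗ LinearMap.adjoint (X.coboundary (k - 1) k (by ring)) +
    LinearMap.adjoint (X.coboundary k (k + 1) rfl) ∘ₗ X.coboundary k (k + 1) rfl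

/-- The set of eigenvalues of the `k`-Laplacian. -/
def eigenvalueSet (X : FaceComplex V) (k : ℤ) : Set ℝ :=
  {x | (X.laplacian k).HasEigenvalue x}

/-- The `k`-th spectral gap `μ_k(X)`, the smallest eigenvalue of the `k`-Laplacian (a genuine
minimum as soon as `X` has a `k`-dimensional simplex). -/
noncomputable def spectralGap (X : FaceComplex V) (k : ℤ) : ℝ := sInf (X.eigenvalueSet k)

end Laplacian

/-- The complex `(Δ_d^{(d-1)})^{*t} * Δ_{r-1}`, for `d ≥ 1`. -/
def extremal (d t r : ℕ) : FaceComplex ((Fin t × Fin (d + 1)) ⊕ Fin r) :=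
  (((complete (Fin (d + 1))).skeleton (d - 1)).joinPow t).join (complete (Fin r))

end FaceComplex

namespace FaceComplex

/-! A set of vertices is a simplex of `Z` exactly when it contains none of `t` disjoint blocks of `d
+ 1` vertices. Call a vertex outside a simplex `σ` a gap if adding it completes a block. A block has
at most one gap, and every vertex outside `σ` that is not a gap extends `σ` to a larger simplex.
Hence the diagonal Laplacian entry, degree plus `|σ|`, is `n - g`, where `g` is the number of gaps
(`AvoidsBlocks.degree_add`). Off the diagonal only exchanges survive: replacing one of the `d` other
vertices of a gap's block by the gap gives an entry `±1` (`AvoidsBlocks.sum_laplacianEntry`).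

A row thus has `d * g` off-diagonal entries `±1`, and Gershgorin's argument bounds every eigenvalue
below by `n - (d + 1) * f`, where `f` is the largest `g` in dimension `k`
(`AvoidsBlocks.le_of_mem_eigenvalueSet`). The bound is attained because exchanges preserve `g` and
signs can be chosen that make every exchange contribute `-1` (`gapSign_exchange`,
`AvoidsBlocks.mem_eigenvalueSet`).

Each gap occupies `d` vertices of `σ`, so `f = min t ⌊(k + 1) / d⌋` (`mul_card_gaps_le`,
`AvoidsBlocks.exists_le_card_gaps`). The same `f` gives the minimal degree `n - (k + 1) - f`, and
eliminating `f` yields the linear relation. -/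

lemma mem_simplices {V : Type*} [Fintype V] {X : FaceComplex V} {k : ℤ} {σ : Finset V} :
    σ ∈ X.simplices k ↔ σ ∈ X.faces ∧ (σ.card : ℤ) = k + 1 := by
  classical
  rw [simplices, Finset.mem_filter, faceDim]
  simp only [Finset.mem_univ, true_and, sub_eq_iff_eq_add]

/-! ### Matrix entries of the Laplacian of an arbitrary complex -/

section Entries

variable {V : Type*} [LinearOrder V]

lemma sgn_mul_self (σ τ : Finset V) : sgn σ τ * sgn σ τ = 1 := by
  unfold sgn
  rw [← mul_pow]
  norm_num

/-- The number of elements of `τ` that are smaller than `v`. -/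
def below (τ : Finset V) (v : V) : ℕ := (τ.filter (· < v)).card

lemma sgn_insert {τ : Finset V} {v : V} (hv : v ∉ τ) :
    sgn (insert v τ) τ = (-1) ^ below τ v := by
  have h : insert v τ \ τ = {v} := by
    ext w
    simp only [Finset.mem_sdiff, Finset.mem_insert, Finset.mem_singleton]
    constructor
    · rintro ⟨h | h, h'⟩
      · exact h
      · exact absurd h h'
    · rintro rfl
      exact ⟨Or.inl rfl, hv⟩
  unfold sgn below
  rw [h]
  congr 1
  refine Finset.card_bij (fun p _ => p.2) ?_ ?_ ?_
  · rintro ⟨a, b⟩ hab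
    simp only [Finset.mem_filter, Finset.mem_product, Finset.mem_singleton] at hab ⊢
    obtain ⟨⟨rfl, hb⟩, hlt⟩ := hab
    exact ⟨hb, hlt⟩
  · rintro ⟨a, b⟩ hab ⟨a', b'⟩ hab' heq
    simp only [Finset.mem_filter, Finset.mem_product, Finset.mem_singleton] at hab hab'
    simp only at heq
    rw [hab.1.1, hab'.1.1, heq]
  · intro b hb
    simp only [Finset.mem_filter] at hb
    exact ⟨(v, b), by simp [hb.1, hb.2], rfl⟩

/-- The incidence number of two finite sets. -/
def incidence (σ τ : Finset V) : ℝ := if τ ⊆ σ then sgn σ τ else 0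

lemma incidence_of_not_subset {σ τ : Finset V} (h : ¬ τ ⊆ σ) : incidence σ τ = 0 := if_neg h

lemma incidence_insert {τ : Finset V} {v : V} (hv : v ∉ τ) :
    incidence (insert v τ) τ = (-1) ^ below τ v := by
  rw [incidence, if_pos (Finset.subset_insert _ _), sgn_insert hv]

lemma below_insert {τ : Finset V} {a : V} (ha : a ∉ τ) (b : V) :
    below (insert a τ) b = below τ b + if a < b then 1 else 0 := by
  unfold below
  rw [Finset.filter_insert]
  split_ifs with h
  · rw [Finset.card_insert_of_notMem (by simp [ha])]
  · rfl

variable [Fintype V]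

lemma coboundary_apply (X : FaceComplex V) (j k : ℤ) (h : k = j + 1) (φ : X.Cochains j)
    (σ : X.simplices k) :
    X.coboundary j k h φ σ = ∑ τ : X.simplices j, incidence σ.1 τ.1 * φ τ := by
  simp only [coboundary, LinearMap.coe_mk, AddHom.coe_mk, incidence, ite_mul, zero_mul]

lemma coboundary_adjoint_apply (X : FaceComplex V) (j k : ℤ) (h : k = j + 1) (ψ : X.Cochains k)
    (τ : X.simplices j) :
    LinearMap.adjoint (X.coboundary j k h) ψ τ
      = ∑ σ : X.simplices k, incidence σ.1 τ.1 * ψ σ := by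
  classical
  -- A coordinate is an inner product with a unit vector, so the adjoint can be moved across.
  have h1 : LinearMap.adjoint (X.coboundary j k h) ψ τ
      = inner ℝ (EuclideanSpace.single τ (1 : ℝ)) (LinearMap.adjoint (X.coboundary j k h) ψ) := by
    rw [EuclideanSpace.inner_single_left]
    simp
  rw [h1, LinearMap.adjoint_inner_right, PiLp.inner_apply]
  refine Finset.sum_congr rfl fun σ _ => ?_
  rw [coboundary_apply]
  simp [mul_comm]

/-- The entries of the matrix of the `k`-Laplacian. -/
noncomputable def laplacianEntry (X : FaceComplex V) (k : ℤ) (σ τ : Finset V) : ℝ :=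
  ∑ η ∈ X.simplices (k - 1), incidence σ η * incidence τ η +
    ∑ η ∈ X.simplices (k + 1), incidence η σ * incidence η τ

lemma laplacian_apply (X : FaceComplex V) (k : ℤ) (φ : X.Cochains k) (σ : X.simplices k) :
    X.laplacian k φ σ = ∑ τ : X.simplices k, X.laplacianEntry k σ.1 τ.1 * φ τ := by
  simp only [laplacian, LinearMap.add_apply, LinearMap.comp_apply, PiLp.add_apply,
    coboundary_apply, coboundary_adjoint_apply, laplacianEntry, add_mul, Finset.sum_add_distrib,
    Finset.mul_sum, Finset.sum_mul]
  rw [Finset.sum_comm]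
  congr 1
  · refine Finset.sum_congr rfl fun τ _ => ?_
    rw [← Finset.sum_coe_sort (X.simplices (k - 1))]
    exact Finset.sum_congr rfl fun η _ => by ring
  · rw [Finset.sum_comm]
    refine Finset.sum_congr rfl fun τ _ => ?_
    rw [← Finset.sum_coe_sort (X.simplices (k + 1))]
    exact Finset.sum_congr rfl fun η _ => by ring

lemma card_facets {X : FaceComplex V} {k : ℤ} {σ : Finset V} (hσ : σ ∈ X.simplices k) :
    ((X.simplices (k - 1)).filter (· ⊆ σ)).card = σ.card := by
  have hσ' := mem_simplices.1 hσ
  have : (X.simplices (k - 1)).filter (· ⊆ σ) = σ.image fun v => σ.erase v := by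
    ext η
    simp only [Finset.mem_filter, mem_simplices, Finset.mem_image]
    constructor
    · rintro ⟨⟨_, hc⟩, hs⟩
      have h1 : (σ \ η).card = 1 := by
        have := Finset.card_sdiff_add_card_eq_card hs
        omega
      obtain ⟨v, hv⟩ := Finset.card_eq_one.1 h1
      have hv' : v ∈ σ \ η := by rw [hv]; exact Finset.mem_singleton_self v
      refine ⟨v, (Finset.mem_sdiff.1 hv').1, ?_⟩
      rw [Finset.erase_eq, ← hv, Finset.sdiff_sdiff_eq_self hs]
    · rintro ⟨v, hv, rfl⟩
      refine ⟨⟨X.down_closed σ hσ'.1 _ (Finset.erase_subset _ _), ?_⟩, Finset.erase_subset _ _⟩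
      have := Finset.card_erase_add_one hv
      omega
  rw [this, Finset.card_image_of_injOn]
  intro v hv w hw h
  exact (Finset.erase_inj σ hv).1 h

lemma laplacianEntry_self {X : FaceComplex V} {k : ℤ} {σ : Finset V} (hσ : σ ∈ X.simplices k) :
    X.laplacianEntry k σ σ = X.degree σ + σ.card := by
  have hk : faceDim σ = k := by
    have := (mem_simplices.1 hσ).2
    unfold faceDim
    omega
  rw [← card_facets hσ, degree, hk, add_comm, laplacianEntry]
  simp only [incidence, ite_mul, zero_mul, mul_ite, mul_zero, sgn_mul_self]
  rw [Finset.card_filter, Finset.card_filter]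
  push_cast
  congr 1 <;>
  · refine Finset.sum_congr rfl fun η _ => ?_
    split_ifs <;> rfl

/-- No simplex contains both, so the upper Laplacian contributes nothing and the common facet `ρ`
alone determines the entry. -/
lemma laplacianEntry_insert_insert {X : FaceComplex V} {k : ℤ} {ρ : Finset V} {a b : V}
    (ha : a ∉ ρ) (hb : b ∉ ρ) (hab : a ≠ b) (hσ : insert b ρ ∈ X.simplices k)
    (hn : insert a (insert b ρ) ∉ X.faces) :
    X.laplacianEntry k (insert b ρ) (insert a ρ) = (-1) ^ (below ρ a + below ρ b) := by
  obtain ⟨hσX, hσc⟩ := mem_simplices.1 hσ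
  rw [Finset.card_insert_of_notMem hb] at hσc
  have hup : ∑ η ∈ X.simplices (k + 1), incidence η (insert b ρ) * incidence η (insert a ρ) = 0 := by
    refine Finset.sum_eq_zero fun η hη => ?_
    by_contra hne
    have h1 : insert b ρ ⊆ η := by
      by_contra h
      exact hne (by rw [incidence_of_not_subset h, zero_mul])
    have h2 : insert a ρ ⊆ η := by
      by_contra h
      exact hne (by rw [incidence_of_not_subset h, mul_zero])
    exact hn (X.down_closed η (mem_simplices.1 hη).1 _
      (Finset.insert_subset (h2 (Finset.mem_insert_self _ _)) h1))
  rw [laplacianEntry, hup, add_zero, Finset.sum_eq_single ρ]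
  · rw [incidence_insert ha, incidence_insert hb, pow_add, mul_comm]
  · intro η hη hne
    by_contra hz
    have h1 : η ⊆ insert b ρ := by
      by_contra h
      exact hz (by rw [incidence_of_not_subset h, zero_mul])
    have h2 : η ⊆ insert a ρ := by
      by_contra h
      exact hz (by rw [incidence_of_not_subset h, mul_zero])
    refine hne (Finset.eq_of_subset_of_card_le (fun v hv => ?_) ?_)
    · have hv1 := h1 hv
      have hv2 := h2 hv
      rw [Finset.mem_insert] at hv1 hv2
      rcases hv1 with rfl | h
      · rcases hv2 with rfl | h
        · exact absurd rfl hab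
        · exact h
      · exact h
    · have := (mem_simplices.1 hη).2
      push_cast at hσc
      omega
  · intro h
    refine absurd (mem_simplices.2 ⟨X.down_closed _ hσX _ (Finset.subset_insert _ _), ?_⟩) h
    push_cast at hσc
    omega

/-- The contributions of the common facet and of the common coface cancel, as in `d ∘ d = 0`. -/
lemma laplacianEntry_insert_insert_of_mem {X : FaceComplex V} {k : ℤ} {ρ : Finset V} {a b : V}
    (ha : a ∉ ρ) (hb : b ∉ ρ) (hab : a ≠ b) (hσ : insert b ρ ∈ X.simplices k)
    (hn : insert a (insert b ρ) ∈ X.faces) :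
    X.laplacianEntry k (insert b ρ) (insert a ρ) = 0 := by
  obtain ⟨hσX, hσc⟩ := mem_simplices.1 hσ
  have hab' : a ∉ insert b ρ := by simp [hab, ha]
  have hba' : b ∉ insert a ρ := by simp [hab.symm, hb]
  rw [Finset.card_insert_of_notMem hb] at hσc
  push_cast at hσc
  have hUc : ((insert a (insert b ρ)).card : ℤ) = k + 2 := by
    rw [Finset.card_insert_of_notMem hab', Finset.card_insert_of_notMem hb]
    push_cast
    omega
  rw [laplacianEntry, Finset.sum_eq_single ρ, Finset.sum_eq_single (insert a (insert b ρ))]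
  · rw [incidence_insert hab', Finset.insert_comm, incidence_insert hba', incidence_insert ha,
      incidence_insert hb, below_insert hb, below_insert ha]
    -- Whichever of `a`, `b` comes first shifts the position of the other by one, so the two
    -- products have opposite signs.
    rcases lt_or_gt_of_ne hab with h | h
    · rw [if_neg h.not_gt, if_pos h]
      ring
    · rw [if_neg h.not_gt, if_pos h]
      ring
  · intro η hη hne
    by_contra hz
    have h1 : insert b ρ ⊆ η := by
      by_contra h
      exact hz (by rw [incidence_of_not_subset h, zero_mul])
    have h2 : insert a ρ ⊆ η := by
      by_contra h
      exact hz (by rw [incidence_of_not_subset h, mul_zero])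
    refine hne (Finset.eq_of_subset_of_card_le
      (Finset.insert_subset (h2 (Finset.mem_insert_self _ _)) h1) ?_).symm
    have := (mem_simplices.1 hη).2
    omega
  · intro h
    exact absurd (mem_simplices.2 ⟨hn, by omega⟩) h
  · intro η hη hne
    by_contra hz
    have h1 : η ⊆ insert b ρ := by
      by_contra h
      exact hz (by rw [incidence_of_not_subset h, zero_mul])
    have h2 : η ⊆ insert a ρ := by
      by_contra h
      exact hz (by rw [incidence_of_not_subset h, mul_zero])
    refine hne (Finset.eq_of_subset_of_card_le (fun v hv => ?_) ?_)
    · have hv1 := h1 hv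
      have hv2 := h2 hv
      rw [Finset.mem_insert] at hv1 hv2
      rcases hv1 with rfl | h
      · rcases hv2 with rfl | h
        · exact absurd rfl hab
        · exact h
      · exact h
    · have := (mem_simplices.1 hη).2
      omega
  · intro h
    refine absurd (mem_simplices.2 ⟨X.down_closed _ hσX _ (Finset.subset_insert _ _), ?_⟩) h
    omega

/-- A nonzero off-diagonal entry of the Laplacian belongs to two simplices that differ by the
exchange of one vertex and whose union is not a simplex. -/
lemma exists_of_laplacianEntry_ne_zero {X : FaceComplex V} {k : ℤ} {σ τ : Finset V}
    (hσ : σ ∈ X.simplices k) (hτ : τ ∈ X.simplices k) (hne : σ ≠ τ)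
    (h : X.laplacianEntry k σ τ ≠ 0) :
    ∃ a b, a ∉ σ ∧ b ∈ σ ∧ τ = insert a (σ.erase b) ∧ insert a σ ∉ X.faces := by
  have hσc := (mem_simplices.1 hσ).2
  have hτc := (mem_simplices.1 hτ).2
  -- Simplices that differ in more than one vertex have neither a common facet nor a common coface.
  have hcard : (σ \ τ).card = 1 := by
    have hpos : 0 < (σ \ τ).card := by
      rw [Finset.card_pos, Finset.sdiff_nonempty]
      exact fun hs => hne (Finset.eq_of_subset_of_card_le hs (by omega))
    have hadd := Finset.card_sdiff_add_card_inter σ τ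
    by_contra hc
    apply h
    rw [laplacianEntry, Finset.sum_eq_zero, Finset.sum_eq_zero, add_zero]
    · intro η hη
      by_contra hz
      have h1 : σ ⊆ η := by
        by_contra h
        exact hz (by rw [incidence_of_not_subset h, zero_mul])
      have h2 : τ ⊆ η := by
        by_contra h
        exact hz (by rw [incidence_of_not_subset h, mul_zero])
      have h3 := Finset.card_le_card (Finset.union_subset h1 h2)
      have h4 := Finset.card_union_add_card_inter σ τ
      have := (mem_simplices.1 hη).2
      omega
    · intro η hη
      by_contra hz
      have h1 : η ⊆ σ := by
        by_contra h
        exact hz (by rw [incidence_of_not_subset h, zero_mul])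
      have h2 : η ⊆ τ := by
        by_contra h
        exact hz (by rw [incidence_of_not_subset h, mul_zero])
      have h3 := Finset.card_le_card (Finset.subset_inter h1 h2)
      have := (mem_simplices.1 hη).2
      omega
  have hcard' : (τ \ σ).card = 1 := by
    have h1 := Finset.card_sdiff_add_card_inter σ τ
    have h2 := Finset.card_sdiff_add_card_inter τ σ
    rw [Finset.inter_comm] at h2
    omega
  obtain ⟨b, hb⟩ := Finset.card_eq_one.1 hcard
  obtain ⟨a, ha⟩ := Finset.card_eq_one.1 hcard'
  have hb' : ∀ v, (v ∈ σ ∧ v ∉ τ) ↔ v = b := fun v => by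
    rw [← Finset.mem_sdiff, hb, Finset.mem_singleton]
  have ha' : ∀ v, (v ∈ τ ∧ v ∉ σ) ↔ v = a := fun v => by
    rw [← Finset.mem_sdiff, ha, Finset.mem_singleton]
  have hbσ := (hb' b).2 rfl
  have haσ := (ha' a).2 rfl
  have hτ_eq : τ = insert a (σ.erase b) := by
    ext v
    rw [Finset.mem_insert, Finset.mem_erase]
    have h1 := hb' v
    have h2 := ha' v
    tauto
  refine ⟨a, b, haσ.2, hbσ.1, hτ_eq, fun hin => h ?_⟩
  have hab : a ≠ b := fun h => haσ.2 (h ▸ hbσ.1)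
  rw [← Finset.insert_erase hbσ.1] at hσ hin
  have := laplacianEntry_insert_insert_of_mem (fun h => haσ.2 (Finset.mem_of_mem_erase h))
    (Finset.notMem_erase b σ) hab hσ hin
  rwa [← hτ_eq, Finset.insert_erase hbσ.1] at this

end Entries

end FaceComplex

namespace FaceComplex

/-- The set of vertices of colour `i`. -/
def block {V : Type*} [Fintype V] (c : V → ℕ) (i : ℕ) : Finset V := Finset.univ.filter fun v => c v = i

lemma mem_block {V : Type*} [Fintype V] {c : V → ℕ} {i : ℕ} {v : V} : v ∈ block c i ↔ c v = i := by simp [block]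

/-! ### Gaps and exchanges in a complex that avoids disjoint blocks -/

section Blocks

variable {V : Type*} [Fintype V] [LinearOrder V]

/-- `X` consists of the vertex sets that contain none of the blocks `0, …, t - 1` of `c`. -/
def AvoidsBlocks (X : FaceComplex V) (c : V → ℕ) (t : ℕ) : Prop :=
  ∀ σ, σ ∈ X.faces ↔ ∀ i < t, ¬ block c i ⊆ σ

/-- The vertices outside `σ` that complete a block when they are added to `σ`. -/
def gaps (c : V → ℕ) (t : ℕ) (σ : Finset V) : Finset V :=
  Finset.univ.filter fun v => v ∉ σ ∧ c v < t ∧ block c (c v) ⊆ insert v σ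

/-- The pairs `(a, b)` such that exchanging `b ∈ σ` for the gap `a` in the block of `b` is
possible. -/
def exchanges (c : V → ℕ) (t : ℕ) (σ : Finset V) : Finset (V × V) :=
  Finset.univ.filter fun p => p.1 ∈ gaps c t σ ∧ c p.2 = c p.1 ∧ p.2 ≠ p.1

variable {c : V → ℕ} {t : ℕ} {X : FaceComplex V}

lemma mem_gaps {σ : Finset V} {v : V} :
    v ∈ gaps c t σ ↔ v ∉ σ ∧ c v < t ∧ block c (c v) ⊆ insert v σ := by simp [gaps]

lemma mem_exchanges {σ : Finset V} {a b : V} :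
    (a, b) ∈ exchanges c t σ ↔ a ∈ gaps c t σ ∧ c b = c a ∧ b ≠ a := by simp [exchanges]

lemma snd_mem_of_mem_exchanges {σ : Finset V} {a b : V} (h : (a, b) ∈ exchanges c t σ) :
    b ∈ σ := by
  obtain ⟨ha, hc, hne⟩ := mem_exchanges.1 h
  exact Finset.mem_of_mem_insert_of_ne ((mem_gaps.1 ha).2.2 (mem_block.2 hc)) hne

/-- Two gaps in one block would each have to lie in `σ` already, unless they coincide. -/
lemma injOn_gaps {σ : Finset V} : Set.InjOn c (gaps c t σ) := by
  intro a ha b hb hab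
  obtain ⟨h1, h2, h3⟩ := mem_gaps.1 ha
  obtain ⟨h1', h2', h3'⟩ := mem_gaps.1 hb
  have := h3 (mem_block.2 hab.symm)
  rw [Finset.mem_insert] at this
  exact (this.resolve_right h1').symm

lemma AvoidsBlocks.insert_notMem_iff (hX : X.AvoidsBlocks c t) {σ : Finset V} (hσ : σ ∈ X.faces)
    {v : V} (hv : v ∉ σ) : insert v σ ∉ X.faces ↔ v ∈ gaps c t σ := by
  rw [mem_gaps, hX]
  push Not
  constructor
  · rintro ⟨i, hi, hs⟩
    have hvi : c v = i := by
      by_contra hne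
      refine (hX σ).1 hσ i hi fun w hw => Finset.mem_of_mem_insert_of_ne (hs hw) ?_
      rintro rfl
      exact hne (mem_block.1 hw)
    subst hvi
    exact ⟨hv, hi, hs⟩
  · rintro ⟨_, hi, hs⟩
    exact ⟨_, hi, hs⟩

/-- The cofaces of `σ` correspond to the vertices outside `σ` that are not gaps. -/
lemma AvoidsBlocks.degree_add (hX : X.AvoidsBlocks c t) {σ : Finset V} (hσ : σ ∈ X.faces) :
    X.degree σ + σ.card + (gaps c t σ).card = Fintype.card V := by
  classical
  have h1 : (X.simplices (faceDim σ + 1)).filter (fun η => σ ⊆ η)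
      = (σᶜ \ gaps c t σ).image fun v => insert v σ := by
    ext η
    simp only [Finset.mem_filter, mem_simplices, Finset.mem_image, Finset.mem_sdiff,
      Finset.mem_compl, faceDim]
    constructor
    · rintro ⟨⟨hη, hc⟩, hs⟩
      have : (η \ σ).card = 1 := by
        have := Finset.card_sdiff_add_card_eq_card hs
        omega
      obtain ⟨v, hv⟩ := Finset.card_eq_one.1 this
      have hη' : insert v σ = η := by
        rw [← Finset.sdiff_union_of_subset hs, hv, Finset.insert_eq]
      have hvσ : v ∉ σ := by
        have : v ∈ η \ σ := by rw [hv]; exact Finset.mem_singleton_self v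
        exact (Finset.mem_sdiff.1 this).2
      refine ⟨v, ⟨hvσ, fun hg => (hX.insert_notMem_iff hσ hvσ).2 hg (hη' ▸ hη)⟩, hη'⟩
    · rintro ⟨v, ⟨hv, hg⟩, rfl⟩
      refine ⟨⟨?_, ?_⟩, Finset.subset_insert _ _⟩
      · by_contra h
        exact hg ((hX.insert_notMem_iff hσ hv).1 h)
      · rw [Finset.card_insert_of_notMem hv]
        push_cast
        ring
  have h2 : X.degree σ = (σᶜ \ gaps c t σ).card := by
    have : X.degree σ = ((X.simplices (faceDim σ + 1)).filter (fun η => σ ⊆ η)).card := by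
      unfold degree
      congr
    rw [this, h1, Finset.card_image_of_injOn]
    intro v hv w hw h
    simp only [Finset.coe_sdiff, Finset.coe_compl, Set.mem_sdiff, Set.mem_compl_iff,
      Finset.mem_coe] at hv
    exact (Finset.insert_inj hv.1).1 h
  have h3 : gaps c t σ ⊆ σᶜ := fun v hv => Finset.mem_compl.2 (mem_gaps.1 hv).1
  have h4 := Finset.card_sdiff_add_card_eq_card h3
  have h5 := Finset.card_compl_add_card σ
  omega

lemma card_exchanges {d : ℕ} (hc : ∀ i < t, (block c i).card = d + 1) (σ : Finset V) :
    (exchanges c t σ).card = d * (gaps c t σ).card := by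
  rw [Finset.card_eq_sum_card_fiberwise (f := Prod.fst) (t := gaps c t σ)
    (fun p hp => (mem_exchanges.1 hp).1), mul_comm]
  refine Finset.sum_const_nat fun a ha => ?_
  have h : (exchanges c t σ).filter (fun p => p.1 = a)
      = ((block c (c a)).erase a).map ⟨fun b => (a, b), fun b b' h => (Prod.mk.inj h).2⟩ := by
    ext ⟨x, y⟩
    simp only [Finset.mem_filter, mem_exchanges, Finset.mem_map, Finset.mem_erase, mem_block]
    constructor
    · rintro ⟨⟨_, h1, h2⟩, rfl⟩
      exact ⟨y, ⟨h2, h1⟩, rfl⟩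
    · rintro ⟨b, ⟨h1, h2⟩, h⟩
      obtain ⟨rfl, rfl⟩ := Prod.mk.inj h
      exact ⟨⟨ha, h2, h1⟩, rfl⟩
  rw [h, Finset.card_map, Finset.card_erase_of_mem (mem_block.2 rfl), hc _ (mem_gaps.1 ha).2.1]
  rfl

lemma card_gaps_le (σ : Finset V) : (gaps c t σ).card ≤ t := by
  rw [← Finset.card_image_of_injOn (injOn_gaps (c := c) (t := t) (σ := σ))]
  refine (Finset.card_le_card (t := Finset.range t) fun i hi => ?_).trans (Finset.card_range t).le
  obtain ⟨a, ha, rfl⟩ := Finset.mem_image.1 hi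
  exact Finset.mem_range.2 (mem_gaps.1 ha).2.1

/-- An exchange is determined by the vertex it removes, since that vertex fixes the block and the
block has only one gap. The `d * g` exchanges therefore inject into `σ`. -/
lemma mul_card_gaps_le {d : ℕ} (hc : ∀ i < t, (block c i).card = d + 1) (σ : Finset V) :
    d * (gaps c t σ).card ≤ σ.card := by
  rw [← card_exchanges hc]
  refine Finset.card_le_card_of_injOn Prod.snd
    (fun p hp => snd_mem_of_mem_exchanges (a := p.1) (b := p.2) hp) ?_
  rintro ⟨a, b⟩ h ⟨a', b'⟩ h' (rfl : b = b')
  obtain ⟨h1, h2, _⟩ := mem_exchanges.1 h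
  obtain ⟨h1', h2', _⟩ := mem_exchanges.1 h'
  rw [injOn_gaps h1 h1' (h2.symm.trans h2')]

lemma AvoidsBlocks.exchange_mem (hX : X.AvoidsBlocks c t) {k : ℤ} {σ : Finset V}
    (hσ : σ ∈ X.simplices k) {a b : V} (h : (a, b) ∈ exchanges c t σ) :
    insert a (σ.erase b) ∈ X.simplices k := by
  have hb := snd_mem_of_mem_exchanges h
  obtain ⟨hag, hc, hne⟩ := mem_exchanges.1 h
  have ha := (mem_gaps.1 hag).1
  obtain ⟨hσX, hσc⟩ := mem_simplices.1 hσ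
  refine mem_simplices.2 ⟨(hX _).2 fun i hi hs => ?_, ?_⟩
  · by_cases hai : c a = i
    · have := hs (mem_block.2 (hc.trans hai))
      simp [hne] at this
    · refine (hX σ).1 hσX i hi fun w hw => ?_
      refine Finset.mem_of_mem_erase (Finset.mem_of_mem_insert_of_ne (hs hw) ?_)
      rintro rfl
      exact hai (mem_block.1 hw)
  · rw [Finset.card_insert_of_notMem (fun h => ha (Finset.mem_of_mem_erase h)),
      Finset.card_erase_add_one hb, hσc]

/-- This is the row of the Laplacian at `σ`, with the off-diagonal part indexed by exchanges. -/
lemma AvoidsBlocks.sum_laplacianEntry (hX : X.AvoidsBlocks c t) {k : ℤ} {σ : Finset V}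
    (hσ : σ ∈ X.simplices k) (ψ : Finset V → ℝ) :
    ∑ τ ∈ X.simplices k, X.laplacianEntry k σ τ * ψ τ
      = ((Fintype.card V : ℝ) - (gaps c t σ).card) * ψ σ +
        ∑ p ∈ exchanges c t σ, (-1) ^ (below (σ.erase p.2) p.1 + below (σ.erase p.2) p.2)
          * ψ (insert p.1 (σ.erase p.2)) := by
  have hσX := (mem_simplices.1 hσ).1
  rw [← Finset.add_sum_erase _ _ hσ, laplacianEntry_self hσ]
  congr 1
  · rw [← hX.degree_add hσX]
    push_cast
    ring
  symm
  refine Finset.sum_of_injOn (fun p => insert p.1 (σ.erase p.2)) ?_ ?_ ?_ ?_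
  · rintro ⟨a, b⟩ h ⟨a', b'⟩ h' heq
    simp only [Finset.mem_coe] at h h'
    have hb := snd_mem_of_mem_exchanges h
    have hb' := snd_mem_of_mem_exchanges h'
    have ha := (mem_gaps.1 (mem_exchanges.1 h).1).1
    have ha' := (mem_gaps.1 (mem_exchanges.1 h').1).1
    have h1 : ∀ v, (v = a ∨ v ≠ b ∧ v ∈ σ) ↔ (v = a' ∨ v ≠ b' ∧ v ∈ σ) := fun v => by
      simpa only [Finset.mem_insert, Finset.mem_erase] using Finset.ext_iff.1 heq v
    have haa : a = a' := ((h1 a).1 (Or.inl rfl)).resolve_right fun h => ha h.2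
    subst haa
    have hbb : b = b' := by
      by_contra hne
      rcases (h1 b).2 (Or.inr ⟨hne, hb⟩) with h | h
      · exact ha (h ▸ hb)
      · exact h.1 rfl
    rw [hbb]
  · rintro ⟨a, b⟩ h
    have ha := (mem_gaps.1 (mem_exchanges.1 h).1).1
    exact Finset.mem_erase.2 ⟨fun h => ha (h ▸ Finset.mem_insert_self _ _), hX.exchange_mem hσ h⟩
  · intro τ hτ hni
    obtain ⟨hne, hτ⟩ := Finset.mem_erase.1 hτ
    by_contra hz
    obtain ⟨a, b, ha, hb, rfl, hU⟩ :=
      exists_of_laplacianEntry_ne_zero hσ hτ hne.symm fun h => hz (by rw [h, zero_mul])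
    have hag := (hX.insert_notMem_iff hσX ha).1 hU
    refine hni ⟨(a, b), mem_exchanges.2 ⟨hag, ?_, fun h => ha (h ▸ hb)⟩, rfl⟩
    -- If `b` lay in another block, `τ` would contain the whole block completed by `a`.
    by_contra hcb
    obtain ⟨_, hi, hs⟩ := mem_gaps.1 hag
    refine (hX _).1 (mem_simplices.1 hτ).1 _ hi fun w hw => ?_
    have hwb : w ≠ b := fun h => hcb (h ▸ mem_block.1 hw)
    rcases Finset.mem_insert.1 (hs hw) with rfl | hw
    · exact Finset.mem_insert_self _ _
    · exact Finset.mem_insert_of_mem (Finset.mem_erase.2 ⟨hwb, hw⟩)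
  · rintro ⟨a, b⟩ h
    have hb := snd_mem_of_mem_exchanges h
    obtain ⟨hag, hc, hne⟩ := mem_exchanges.1 h
    have ha := (mem_gaps.1 hag).1
    have h1 := (hX.insert_notMem_iff hσX ha).2 hag
    have := laplacianEntry_insert_insert (ρ := σ.erase b) (X := X) (k := k)
      (fun h => ha (Finset.mem_of_mem_erase h)) (Finset.notMem_erase b σ) hne.symm
      (by rwa [Finset.insert_erase hb]) (by rwa [Finset.insert_erase hb])
    rw [Finset.insert_erase hb] at this
    simp only [this]

/-- Within the affected block the gap moves from `a` to `b`; the other blocks are untouched. In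
particular the number of gaps and the set `σ ∪ gaps c t σ` are invariant under exchanges. -/
lemma gaps_exchange {σ : Finset V} {a b : V} (h : (a, b) ∈ exchanges c t σ) :
    gaps c t (insert a (σ.erase b)) = insert b ((gaps c t σ).erase a) := by
  have hb := snd_mem_of_mem_exchanges h
  obtain ⟨hag, hc, hne⟩ := mem_exchanges.1 h
  obtain ⟨ha, hi, hs⟩ := mem_gaps.1 hag
  ext v
  by_cases hv : c v = c a
  · have h1 : v ∈ insert b ((gaps c t σ).erase a) ↔ v = b := by
      rw [Finset.mem_insert, Finset.mem_erase]
      refine or_iff_left fun h => h.1 (injOn_gaps h.2 hag hv)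
    rw [h1, mem_gaps]
    constructor
    · rintro ⟨_, _, h⟩
      have := h (mem_block.2 (hc.trans hv.symm))
      simp only [Finset.mem_insert, Finset.mem_erase, ne_eq, not_true_eq_false, false_and,
        or_false] at this
      rcases this with h | h
      · exact h.symm
      · exact absurd h hne
    · rintro rfl
      refine ⟨by simp [hne], hc ▸ hi, ?_⟩
      rwa [Finset.insert_comm, Finset.insert_erase hb, hc]
  · have hva : v ≠ a := fun h => hv (h ▸ rfl)
    have hvb : v ≠ b := fun h => hv (h ▸ hc)
    rw [Finset.mem_insert, Finset.mem_erase, mem_gaps, mem_gaps]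
    simp only [hva, hvb, false_or, ne_eq, not_false_eq_true, true_and, Finset.mem_insert,
      Finset.mem_erase]
    refine and_congr_right fun _ => and_congr_right fun _ => ?_
    refine forall₂_congr fun w hw => ?_
    have hwa : w ≠ a := fun h => hv (h ▸ (mem_block.1 hw).symm)
    have hwb : w ≠ b := fun h => hv (hc ▸ h ▸ (mem_block.1 hw).symm)
    simp [hwa, hwb]

end Blocks

end FaceComplex

namespace FaceComplex

/-! ### The parity computation behind the eigenvector -/

section Signs

variable {V : Type*} [LinearOrder V]

/-- The number of pairs `(w, a)` with `a ∈ A`, `w ∈ T` and `w < a`, plus the number of inversions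
of `c` on `A`. -/
def gapExponent (c : V → ℕ) (A T : Finset V) : ℕ :=
  ∑ a ∈ A, below T a + ∑ x ∈ A, ∑ y ∈ A, if x < y ∧ c y < c x then 1 else 0

lemma below_eq_sum (τ : Finset V) (v : V) : below τ v = ∑ x ∈ τ, if x < v then 1 else 0 := by
  rw [below, Finset.card_filter]

/-- Up to a sign depending only on `|A|`, `(-1) ^ gapExponent c A T` is the sign of deleting the
elements of `A` from `T` in the order of their colours. Apart from `C`, the new factor due to `a`
depends only on the colour of `a` and its position in `T \ C`. -/
lemma even_gapExponent_insert {c : V → ℕ} {C T : Finset V} {a : V} (ha : a ∉ C)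
    (hC : C ⊆ T) (hc : ∀ x ∈ C, c x ≠ c a) :
    Even (gapExponent c (insert a C) T + gapExponent c C T + below (T \ C) a
      + ∑ x ∈ C, if c x < c a then 1 else 0) := by
  have hT : below T a = below (T \ C) a + below C a := by
    simp only [below_eq_sum]
    exact (Finset.sum_sdiff hC).symm
  -- For each `x ∈ C`, an even number of the four conditions hold.
  have hE : Even (∑ x ∈ C, ((if a < x ∧ c x < c a then 1 else 0) +
      (if x < a ∧ c a < c x then 1 else 0) + (if x < a then 1 else 0) +
      (if c x < c a then 1 else 0))) := by
    refine Finset.even_sum _ fun x hx => ?_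
    have hxa : x ≠ a := fun h => ha (h ▸ hx)
    rcases lt_or_gt_of_ne hxa with h1 | h1 <;> rcases lt_or_gt_of_ne (hc x hx) with h2 | h2 <;>
      simp [h1, h2, h1.not_gt, h2.not_gt]
  simp only [Finset.sum_add_distrib, ← below_eq_sum] at hE
  have hins : gapExponent c (insert a C) T = gapExponent c C T + below T a
      + (∑ x ∈ C, if a < x ∧ c x < c a then 1 else 0)
      + ∑ x ∈ C, if x < a ∧ c a < c x then 1 else 0 := by
    simp only [gapExponent, Finset.sum_insert ha, lt_irrefl, false_and, if_false, zero_add,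
      Finset.sum_add_distrib]
    ring
  rw [hins, hT]
  rw [Nat.even_iff] at hE ⊢
  omega

end Signs

/-! ### Both bounds for the smallest eigenvalue -/

section Spectrum

variable {V : Type*} [Fintype V] [LinearOrder V] {c : V → ℕ} {t : ℕ} {X : FaceComplex V}

/-- The values of the eigenvector of smallest eigenvalue, on the simplices with most gaps. -/
def gapSign (c : V → ℕ) (t : ℕ) (σ : Finset V) : ℝ :=
  (-1) ^ gapExponent c (gaps c t σ) (σ ∪ gaps c t σ)

/-- With `C` the remaining gaps and `T = σ ∪ gaps c t σ`, the two exponents differ, modulo 2, by the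
positions of `a` and `b` in `T \ C = ρ ∪ {a, b}`. Compared with positions in `ρ`, exactly one is
shifted by one, which produces the minus sign. -/
lemma gapSign_exchange {σ : Finset V} {a b : V} (h : (a, b) ∈ exchanges c t σ) :
    (-1) ^ (below (σ.erase b) a + below (σ.erase b) b) * gapSign c t (insert a (σ.erase b))
      = - gapSign c t σ := by
  have hb := snd_mem_of_mem_exchanges h
  obtain ⟨hag, hcb, hne⟩ := mem_exchanges.1 h
  have ha := (mem_gaps.1 hag).1
  have hbg : b ∉ gaps c t σ := fun h => (mem_gaps.1 h).1 hb
  obtain ⟨C, hC⟩ : ∃ C, C = (gaps c t σ).erase a := ⟨_, rfl⟩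
  obtain ⟨ρ, hρ⟩ : ∃ ρ, ρ = σ.erase b := ⟨_, rfl⟩
  have haC : a ∉ C := hC ▸ Finset.notMem_erase _ _
  have hbC : b ∉ C := fun h => hbg (Finset.mem_of_mem_erase (hC ▸ h))
  have haρ : a ∉ ρ := fun h => ha (Finset.mem_of_mem_erase (hρ ▸ h))
  have hbρ : b ∉ ρ := hρ ▸ Finset.notMem_erase _ _
  have hgσ : gaps c t σ = insert a C := by rw [hC, Finset.insert_erase hag]
  have hσ : σ = insert b ρ := by rw [hρ, Finset.insert_erase hb]
  have hcC : ∀ x ∈ C, c x ≠ c a := by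
    intro x hx hxa
    rw [hC] at hx
    exact (Finset.mem_erase.1 hx).1 (injOn_gaps (Finset.mem_of_mem_erase hx) hag hxa)
  have hTτ : insert a ρ ∪ insert b C = σ ∪ insert a C := by
    rw [hσ]
    ext v
    simp only [Finset.mem_union, Finset.mem_insert]
    tauto
  have hCT : C ⊆ σ ∪ insert a C :=
    (Finset.subset_insert _ _).trans Finset.subset_union_right
  have hTC : (σ ∪ insert a C) \ C = insert a (insert b ρ) := by
    rw [← hσ]
    ext v
    have : v ∈ C → v ∉ σ := fun hv =>
      (mem_gaps.1 (Finset.mem_of_mem_erase (hC ▸ hv))).1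
    have hva : v = a → v ∉ C := fun h => h ▸ haC
    simp only [Finset.mem_union, Finset.mem_insert, Finset.mem_sdiff]
    tauto
  have e1 := even_gapExponent_insert haC hCT hcC
  have e2 := even_gapExponent_insert hbC hCT (hcb ▸ hcC)
  have hab' : a ∉ insert b ρ := by simp [hne.symm, haρ]
  rw [hTC, below_insert hab', below_insert hbρ, if_neg (lt_irrefl _)] at e1
  rw [hTC, below_insert hab', below_insert hbρ, if_neg (lt_irrefl b), hcb] at e2
  rw [gapSign, gapSign, gaps_exchange h, ← hC, ← hρ, hgσ, hTτ, ← pow_add,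
    neg_eq_neg_one_mul ((-1 : ℝ) ^ _), ← pow_succ']
  apply neg_one_pow_congr
  have hs : (if b < a then 1 else 0) + (if a < b then 1 else 0) = 1 := by
    rcases lt_or_gt_of_ne hne with h | h <;> simp [h, h.not_gt]
  rw [Nat.even_iff] at e1 e2
  rw [Nat.even_iff, Nat.even_iff]
  omega

lemma AvoidsBlocks.laplacian_apply (hX : X.AvoidsBlocks c t) {k : ℤ} (φ : X.Cochains k)
    (ψ : Finset V → ℝ) (hψ : ∀ σ : X.simplices k, φ σ = ψ σ.1) (σ : X.simplices k) :
    X.laplacian k φ σ = ((Fintype.card V : ℝ) - (gaps c t σ.1).card) * ψ σ.1 +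
        ∑ p ∈ exchanges c t σ.1,
          (-1) ^ (below (σ.1.erase p.2) p.1 + below (σ.1.erase p.2) p.2)
          * ψ (insert p.1 (σ.1.erase p.2)) := by
  rw [FaceComplex.laplacian_apply, ← hX.sum_laplacianEntry σ.2,
    ← Finset.sum_coe_sort (X.simplices k)]
  exact Finset.sum_congr rfl fun τ _ => by rw [hψ]

lemma AvoidsBlocks.le_of_mem_eigenvalueSet (hX : X.AvoidsBlocks c t) {d : ℕ}
    (hc : ∀ i < t, (block c i).card = d + 1) {k : ℤ} {f : ℕ}
    (hf : ∀ σ ∈ X.simplices k, (gaps c t σ).card ≤ f) {x : ℝ} (hx : x ∈ X.eigenvalueSet k) :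
    (Fintype.card V : ℝ) - (d + 1) * f ≤ x := by
  classical
  obtain ⟨φ, hφ⟩ := Module.End.HasEigenvalue.exists_hasEigenvector hx
  have hφ0 := hφ.2
  obtain ⟨σ₀, hσ₀⟩ : ∃ σ, φ σ ≠ 0 := by
    by_contra! h
    exact hφ0 (PiLp.ext h)
  -- Gershgorin's argument: compare coordinates at a simplex where the eigenvector is largest in
  -- absolute value.
  obtain ⟨σ, -, hσ⟩ := Finset.exists_max_image Finset.univ (fun σ => |φ σ|) ⟨σ₀, Finset.mem_univ _⟩
  have hpos : 0 < |φ σ| := (abs_pos.2 hσ₀).trans_le (hσ σ₀ (Finset.mem_univ _))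
  obtain ⟨ψ, hψ⟩ : ∃ ψ : Finset V → ℝ, ∀ σ : X.simplices k, φ σ = ψ σ.1 :=
    ⟨fun τ => if h : τ ∈ X.simplices k then φ ⟨τ, h⟩ else 0, fun σ => by simp⟩
  have h1 := hX.laplacian_apply φ ψ hψ σ
  rw [hφ.apply_eq_smul, PiLp.smul_apply, smul_eq_mul, ← hψ] at h1
  have h2 : |∑ p ∈ exchanges c t σ.1,
      (-1) ^ (below (σ.1.erase p.2) p.1 + below (σ.1.erase p.2) p.2)
        * ψ (insert p.1 (σ.1.erase p.2))| ≤ (d * (gaps c t σ.1).card : ℕ) * |φ σ| := by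
    rw [← card_exchanges hc, ← nsmul_eq_mul]
    refine (Finset.abs_sum_le_sum_abs _ _).trans (Finset.sum_le_card_nsmul _ _ _ ?_)
    rintro ⟨a, b⟩ hp
    rw [abs_mul, abs_pow, abs_neg, abs_one, one_pow, one_mul]
    have := hσ ⟨_, hX.exchange_mem σ.2 hp⟩ (Finset.mem_univ _)
    rwa [hψ] at this
  have h3 : (x - ((Fintype.card V : ℝ) - (gaps c t σ.1).card)) * φ σ
      = ∑ p ∈ exchanges c t σ.1,
      (-1) ^ (below (σ.1.erase p.2) p.1 + below (σ.1.erase p.2) p.2)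
        * ψ (insert p.1 (σ.1.erase p.2)) := by
    rw [sub_mul, h1]
    ring
  rw [← h3, abs_mul] at h2
  have h4 := (abs_le.1 (le_of_mul_le_mul_right h2 hpos)).1
  have h5 : ((gaps c t σ.1).card : ℝ) ≤ f := by exact_mod_cast hf σ.1 σ.2
  have h6 : ((d : ℝ) + 1) * (gaps c t σ.1).card ≤ (d + 1) * f := by gcongr
  push_cast at h4
  linarith

lemma AvoidsBlocks.mem_eigenvalueSet (hX : X.AvoidsBlocks c t) {d : ℕ}
    (hc : ∀ i < t, (block c i).card = d + 1) {k : ℤ} {σ₀ : Finset V} (hσ₀ : σ₀ ∈ X.simplices k) :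
    (Fintype.card V : ℝ) - (d + 1) * (gaps c t σ₀).card ∈ X.eigenvalueSet k := by
  classical
  obtain ⟨f, hf⟩ : ∃ f, f = (gaps c t σ₀).card := ⟨_, rfl⟩
  -- Exchanges preserve the number of gaps, so the Laplacian respects the restriction to simplices
  -- with exactly `f` of them; this works for any attained `f`.
  let ψ : Finset V → ℝ := fun σ => if (gaps c t σ).card = f then gapSign c t σ else 0
  let φ : X.Cochains k := WithLp.toLp 2 fun σ => ψ σ.1
  have hφψ : ∀ σ : X.simplices k, φ σ = ψ σ.1 := fun σ => rfl
  refine Module.End.hasEigenvalue_of_hasEigenvector (x := φ)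
    ⟨Module.End.mem_eigenspace_iff.2 (PiLp.ext fun σ => ?_), fun h0 => ?_⟩
  · rw [hX.laplacian_apply φ ψ hφψ, PiLp.smul_apply, smul_eq_mul, hφψ]
    have h1 : ∀ p ∈ exchanges c t σ.1,
        (-1) ^ (below (σ.1.erase p.2) p.1 + below (σ.1.erase p.2) p.2)
          * ψ (insert p.1 (σ.1.erase p.2)) = - ψ σ.1 := by
      rintro ⟨a, b⟩ hp
      have hcard : (gaps c t (insert a (σ.1.erase b))).card = (gaps c t σ.1).card := by
        have hbg : b ∉ gaps c t σ.1 := fun h => (mem_gaps.1 h).1 (snd_mem_of_mem_exchanges hp)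
        rw [gaps_exchange hp, Finset.card_insert_of_notMem
          (fun h => hbg (Finset.mem_of_mem_erase h)),
          Finset.card_erase_add_one (mem_exchanges.1 hp).1]
      simp only [ψ, hcard]
      split_ifs with h
      · exact gapSign_exchange hp
      · simp
    rw [Finset.sum_congr rfl h1, Finset.sum_const, card_exchanges hc, nsmul_eq_mul, ← hf]
    by_cases h : (gaps c t σ.1).card = f
    · rw [h]
      push_cast
      ring
    · have : ψ σ.1 = 0 := if_neg h
      rw [this]
      ring
  · have h1 : φ ⟨σ₀, hσ₀⟩ = 0 := by rw [h0]; rfl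
    have h2 : φ ⟨σ₀, hσ₀⟩ = gapSign c t σ₀ := if_pos hf.symm
    rw [h2, gapSign] at h1
    exact pow_ne_zero _ (by norm_num) h1

end Spectrum

/-! ### Simplices with many gaps, dimension and missing faces -/

section Faces

variable {V : Type*} [Fintype V] [LinearOrder V] {c : V → ℕ} {t : ℕ} {X : FaceComplex V}

/-- Reserve one vertex `x i` of each block. Any set that avoids all reserved vertices is a simplex,
and if it contains the rest of `f` blocks, their reserved vertices are gaps. -/
lemma AvoidsBlocks.exists_le_card_gaps (hX : X.AvoidsBlocks c t) {d : ℕ}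
    (hc : ∀ i < t, (block c i).card = d + 1) {f m : ℕ} (hft : f ≤ t) (hfm : d * f ≤ m)
    (hm : m + t ≤ Fintype.card V) :
    ∃ σ ∈ X.faces, σ.card = m ∧ f ≤ (gaps c t σ).card := by
  have hex : ∀ i : Fin t, ∃ x, c x = i := fun i => by
    obtain ⟨x, hx⟩ := Finset.card_pos.1 (by rw [hc i i.2]; omega : 0 < (block c i).card)
    exact ⟨x, mem_block.1 hx⟩
  choose x hx using hex
  have hxinj : Function.Injective x := fun i j h => Fin.ext (by rw [← hx i, ← hx j, h])
  obtain ⟨F, -, hF⟩ := Finset.exists_subset_card_eq (s := (Finset.univ : Finset (Fin t))) (n := f)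
    (by simpa using hft)
  have hlow : (F.biUnion fun i => (block c i).erase (x i)) ⊆ (Finset.univ.image x)ᶜ := by
    intro v hv
    obtain ⟨i, -, hvi⟩ := Finset.mem_biUnion.1 hv
    rw [Finset.mem_erase, mem_block] at hvi
    rw [Finset.mem_compl, Finset.mem_image]
    rintro ⟨j, -, rfl⟩
    have : i = j := Fin.ext (by rw [← hvi.2, hx])
    exact hvi.1 (by rw [this])
  have hcard : (F.biUnion fun i => (block c i).erase (x i)).card ≤ m := by
    refine (Finset.card_biUnion_le_card_mul F _ d fun i _ => ?_).trans (by rwa [hF, mul_comm])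
    rw [Finset.card_erase_of_mem (mem_block.2 (hx i)), hc i i.2]
    rfl
  obtain ⟨σ, hlσ, hσ, hσm⟩ := Finset.exists_subsuperset_card_eq hlow hcard (by
    rw [Finset.card_compl, Finset.card_image_of_injective _ hxinj, Finset.card_univ,
      Fintype.card_fin]
    omega)
  have hxσ : ∀ i, x i ∉ σ := fun i h =>
    Finset.mem_compl.1 (hσ h) (Finset.mem_image_of_mem x (Finset.mem_univ i))
  refine ⟨σ, (hX σ).2 fun i hi hs => hxσ ⟨i, hi⟩ (hs (mem_block.2 (hx ⟨i, hi⟩))), hσm, ?_⟩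
  rw [← hF, ← Finset.card_image_of_injective F hxinj]
  refine Finset.card_le_card fun v hv => ?_
  obtain ⟨i, hi, rfl⟩ := Finset.mem_image.1 hv
  refine mem_gaps.2 ⟨hxσ i, by rw [hx]; exact i.2, fun w hw => ?_⟩
  rw [hx] at hw
  rw [Finset.mem_insert]
  refine or_iff_not_imp_left.2 fun hne => hlσ (Finset.mem_biUnion.2 ⟨i, hi, ?_⟩)
  exact Finset.mem_erase.2 ⟨hne, hw⟩

/-- A simplex omits a vertex of each of the `t` disjoint blocks. -/
lemma AvoidsBlocks.card_add_le (hX : X.AvoidsBlocks c t) {σ : Finset V} (hσ : σ ∈ X.faces) :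
    σ.card + t ≤ Fintype.card V := by
  have hex : ∀ i : Fin t, ∃ x, c x = i ∧ x ∉ σ := fun i => by
    obtain ⟨x, hx, hxσ⟩ := Finset.not_subset.1 ((hX σ).1 hσ i i.2)
    exact ⟨x, mem_block.1 hx, hxσ⟩
  choose x hx hxσ using hex
  have hxinj : Function.Injective x := fun i j h => Fin.ext (by rw [← hx i, ← hx j, h])
  have h1 : (Finset.univ.image x).card ≤ σᶜ.card := Finset.card_le_card fun v hv => by
    obtain ⟨i, -, rfl⟩ := Finset.mem_image.1 hv
    exact Finset.mem_compl.2 (hxσ i)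
  rw [Finset.card_image_of_injective _ hxinj, Finset.card_univ, Fintype.card_fin] at h1
  have := Finset.card_compl_add_card σ
  omega

lemma AvoidsBlocks.isMissingFace_iff (hX : X.AvoidsBlocks c t)
    (hc : ∀ i < t, (block c i).Nonempty) {σ : Finset V} :
    X.IsMissingFace σ ↔ ∃ i < t, σ = block c i := by
  constructor
  · rintro ⟨h1, h2⟩
    rw [hX] at h1
    push Not at h1
    obtain ⟨i, hi, hs⟩ := h1
    refine ⟨i, hi, ?_⟩
    by_contra hne
    exact (hX _).1 (h2 _ (lt_of_le_of_ne hs (Ne.symm hne))) i hi subset_rfl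
  · rintro ⟨i, hi, rfl⟩
    refine ⟨fun h => (hX _).1 h i hi subset_rfl, fun τ hτ => (hX τ).2 fun j hj hs => ?_⟩
    obtain ⟨v, hv⟩ := hc j hj
    have : j = i := (mem_block.1 hv).symm.trans (mem_block.1 (hτ.1 (hs hv)))
    subst this
    exact hτ.2 hs

end Faces

/-! ### The extremal complex avoids its blocks -/

section Extremal

variable {V : Type*} [Fintype V] {c : V → ℕ} {t : ℕ} {X : FaceComplex V}

lemma AvoidsBlocks.singleton_mem (hX : X.AvoidsBlocks c t)
    (hc : ∀ i < t, 1 < (block c i).card) (v : V) : {v} ∈ X.faces :=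
  (hX _).2 fun i hi hs => by
    have := Finset.card_le_card hs
    have := hc i hi
    simp only [Finset.card_singleton] at *
    omega

/-- The colouring of the vertices of the extremal complex by the index of their block. -/
def blockIndex {d t r : ℕ} {V : Type*} (e : (Fin t × Fin (d + 1)) ⊕ Fin r ≃ V) (v : V) : ℕ :=
  Sum.elim (fun p => (p.1 : ℕ)) (fun _ => t) (e.symm v)

lemma mem_block_blockIndex {d t r : ℕ} (e : (Fin t × Fin (d + 1)) ⊕ Fin r ≃ V) (i : Fin t)
    (v : V) : v ∈ block (blockIndex e) i ↔ ∃ x, e (Sum.inl (i, x)) = v := by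
  rw [mem_block, blockIndex]
  constructor
  · intro h
    rcases hv : e.symm v with ⟨j, x⟩ | j
    · rw [hv] at h
      obtain rfl : j = i := Fin.ext h
      exact ⟨x, by rw [← hv, Equiv.apply_symm_apply]⟩
    -- Vertices of the simplex factor carry the colour `t`, which is no block index.
    · rw [hv] at h
      exact absurd h i.2.ne'
  · rintro ⟨x, rfl⟩
    simp

lemma card_block_blockIndex {d t r : ℕ} (e : (Fin t × Fin (d + 1)) ⊕ Fin r ≃ V) (i : ℕ)
    (hi : i < t) : (block (blockIndex e) i).card = d + 1 := by
  classical
  have : block (blockIndex e) i = Finset.univ.image fun x => e (Sum.inl (⟨i, hi⟩, x)) := by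
    ext v
    rw [mem_block_blockIndex e ⟨i, hi⟩ v]
    simp
  rw [this, Finset.card_image_of_injective, Finset.card_univ, Fintype.card_fin]
  intro x y h
  simpa using h

lemma avoidsBlocks_extremal {d t r : ℕ} (hd : 1 ≤ d) (e : (Fin t × Fin (d + 1)) ⊕ Fin r ≃ V) :
    ((extremal d t r).relabel e).AvoidsBlocks (blockIndex e) t := by
  classical
  intro ρ
  have hsub : (∀ i < t, ¬ block (blockIndex e) i ⊆ ρ)
      ↔ ∀ i : Fin t, ∃ x, e (Sum.inl (i, x)) ∉ ρ := by
    constructor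
    · intro h i
      obtain ⟨v, hv, hvρ⟩ := Finset.not_subset.1 (h i i.2)
      obtain ⟨x, rfl⟩ := (mem_block_blockIndex e i v).1 hv
      exact ⟨x, hvρ⟩
    · intro h i hi hs
      obtain ⟨x, hx⟩ := h ⟨i, hi⟩
      exact hx (hs ((mem_block_blockIndex e ⟨i, hi⟩ _).2 ⟨x, rfl⟩))
  rw [hsub]
  constructor
  · rintro ⟨_, ⟨σ, ⟨s, hs, hσ⟩, τ, -, rfl⟩, rfl⟩ i
    -- The skeleton bound is `d - 1 + 1` with truncated subtraction; it equals `d` because `1 ≤ d`.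
    have hcard : (s i).card < (Finset.univ : Finset (Fin (d + 1))).card := by
      have := (hs i).2
      rw [Finset.card_univ, Fintype.card_fin]
      omega
    obtain ⟨x, -, hx⟩ := Finset.exists_mem_notMem_of_card_lt_card hcard
    refine ⟨x, fun h => hx ((hσ i x).1 ?_)⟩
    simpa using h
  · intro h
    refine ⟨ρ.map e.symm.toEmbedding, ⟨(ρ.map e.symm.toEmbedding).toLeft, ?_,
      (ρ.map e.symm.toEmbedding).toRight, Set.mem_univ _, Finset.toLeft_disjSum_toRight.symm⟩, ?_⟩
    · refine ⟨fun i => Finset.univ.filter fun x => e (Sum.inl (i, x)) ∈ ρ,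
        fun i => ⟨Set.mem_univ _, ?_⟩, fun i x => ?_⟩
      · obtain ⟨x, hx⟩ := h i
        have := Finset.card_lt_card (s := Finset.univ.filter fun x => e (Sum.inl (i, x)) ∈ ρ)
          (t := Finset.univ) (Finset.filter_ssubset.2 ⟨x, Finset.mem_univ _, hx⟩)
        rw [Finset.card_univ, Fintype.card_fin] at this
        dsimp only
        omega
      · simp only [Finset.mem_toLeft, Finset.mem_map_equiv, Equiv.symm_symm, Finset.mem_filter,
          Finset.mem_univ, true_and]
    · ext v
      simp

end Extremal

end FaceComplex

/-! ### Evaluation of the spectral gaps and minimal degrees -/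

theorem proposition3 (d t r n : ℕ) (hd : 1 ≤ d) (hn : n = (d + 1) * t + r)
    {V : Type*} [Fintype V] [LinearOrder V] (e : (Fin t × Fin (d + 1)) ⊕ Fin r ≃ V)
    (Z : FaceComplex V) (hZ : Z = (FaceComplex.extremal d t r).relabel e) :
    -- `Z` has `n` vertices and dimension `dt + r - 1`, and all its missing faces have dimension `d`
    {v : V | {v} ∈ Z.faces}.ncard = n ∧
    IsGreatest {m : ℤ | ∃ σ ∈ Z.faces, m = faceDim σ} ((d : ℤ) * t + r - 1) ∧
    (∀ σ, Z.IsMissingFace σ → faceDim σ = d) ∧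
    (1 ≤ t → IsGreatest {m : ℤ | ∃ σ, Z.IsMissingFace σ ∧ m = faceDim σ} (d : ℤ)) ∧
    -- in each dimension the two minima exist, and they have the stated values
    ∀ k : ℤ, -1 ≤ k → k ≤ (d : ℤ) * t + r - 1 →
      IsLeast (Z.eigenvalueSet k) (Z.spectralGap k) ∧
      IsLeast (Z.degreeSet k) (Z.minDegree k) ∧
      (k ≤ (d : ℤ) * t - 1 →
        Z.spectralGap k = ((d : ℝ) + 1) * ((t : ℝ) - (⌊((k : ℝ) + 1) / (d : ℝ)⌋ : ℝ)) + (r : ℝ)) ∧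
      ((d : ℤ) * t ≤ k → Z.spectralGap k = (r : ℝ)) ∧
      (k ≤ (d : ℤ) * t - 1 →
        (Z.minDegree k : ℤ) = (n : ℤ) - (k + 1) - ⌊((k : ℝ) + 1) / (d : ℝ)⌋) ∧
      ((d : ℤ) * t ≤ k → (Z.minDegree k : ℤ) = (n : ℤ) - (k + 1) - (t : ℤ)) ∧
      Z.spectralGap k
        = ((d : ℝ) + 1) * ((Z.minDegree k : ℝ) + (k : ℝ) + 1) - (d : ℝ) * (n : ℝ) := by
  have hX : Z.AvoidsBlocks (FaceComplex.blockIndex e) t :=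
    hZ ▸ FaceComplex.avoidsBlocks_extremal hd e
  have hc := FaceComplex.card_block_blockIndex e
  generalize FaceComplex.blockIndex e = c at hX hc
  have hV : Fintype.card V = n := by
    rw [← Fintype.card_congr e, hn]
    simp [mul_comm]
  clear hZ e
  have hmiss : ∀ σ, Z.IsMissingFace σ ↔ ∃ i < t, σ = FaceComplex.block c i := fun σ =>
    hX.isMissingFace_iff fun i hi => Finset.card_pos.1 (by rw [hc i hi]; omega)
  have hdim : ∀ i < t, faceDim (FaceComplex.block c i) = d := fun i hi => by
    rw [faceDim, hc i hi]
    push_cast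
    ring
  have hmd : ∀ σ, Z.IsMissingFace σ → faceDim σ = d := fun σ hσ => by
    obtain ⟨i, hi, rfl⟩ := (hmiss σ).1 hσ
    exact hdim i hi
  have hn' : (n : ℤ) = (d : ℤ) * t + t + r := by
    rw [hn]
    push_cast
    ring
  refine ⟨?_, ⟨?_, ?_⟩, hmd, fun ht => ⟨⟨_, (hmiss _).2 ⟨0, ht, rfl⟩, (hdim 0 ht).symm⟩, ?_⟩, ?_⟩
  · have : {v : V | {v} ∈ Z.faces} = Set.univ :=
      Set.eq_univ_of_forall fun v => hX.singleton_mem (fun i hi => by rw [hc i hi]; omega) v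
    rw [this, Set.ncard_univ, Nat.card_eq_fintype_card, hV]
  -- No gaps are requested here; `d * t + r = n - t` is the largest size allowed.
  · obtain ⟨σ, hσ, hm, -⟩ := hX.exists_le_card_gaps hc (f := 0) (m := d * t + r) (Nat.zero_le _)
      (Nat.zero_le _) (by rw [hV]; zify; omega)
    refine ⟨σ, hσ, ?_⟩
    rw [faceDim, hm]
    push_cast
    ring
  · rintro m ⟨σ, hσ, rfl⟩
    have := hX.card_add_le hσ
    rw [faceDim]
    omega
  · rintro m ⟨σ, hσ, rfl⟩
    exact (hmd σ hσ).le
  intro k hk1 hk2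
  obtain ⟨m, hm⟩ : ∃ m : ℕ, (m : ℤ) = k + 1 := ⟨(k + 1).toNat, by omega⟩
  -- The maximal number of gaps among simplices with `m = k + 1` vertices.
  obtain ⟨f, hf⟩ : ∃ f, f = min t (m / d) := ⟨_, rfl⟩
  have hle : ∀ σ ∈ Z.simplices k, (FaceComplex.gaps c t σ).card ≤ f := by
    intro σ hσ
    have h1 := FaceComplex.mul_card_gaps_le hc σ
    have h2 := (FaceComplex.mem_simplices.1 hσ).2
    have h3 : σ.card = m := by omega
    rw [hf]
    refine le_min (FaceComplex.card_gaps_le σ) ((Nat.le_div_iff_mul_le hd).2 ?_)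
    rwa [mul_comm, ← h3]
  obtain ⟨σ, hσ, hσm, hfσ⟩ := hX.exists_le_card_gaps hc (f := f) (m := m)
    (by rw [hf]; exact min_le_left _ _)
    (by rw [mul_comm]; exact (Nat.le_div_iff_mul_le hd).1 (by rw [hf]; exact min_le_right _ _))
    (by rw [hV]; zify; omega)
  have hσk : σ ∈ Z.simplices k := FaceComplex.mem_simplices.2 ⟨hσ, by omega⟩
  have hσf : (FaceComplex.gaps c t σ).card = f := le_antisymm (hle σ hσk) hfσ
  have hgap : IsLeast (Z.eigenvalueSet k) ((n : ℝ) - (d + 1) * f) := by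
    refine ⟨?_, fun x hx => ?_⟩
    · have := hX.mem_eigenvalueSet hc hσk
      rwa [hσf, hV] at this
    · rw [← hV]
      exact hX.le_of_mem_eigenvalueSet hc hle hx
  have hdeg : IsLeast (Z.degreeSet k) (Z.degree σ) := by
    refine ⟨⟨σ, hσk, rfl⟩, ?_⟩
    rintro _ ⟨τ, hτ, rfl⟩
    have h1 := hX.degree_add hσ
    have h2 := FaceComplex.mem_simplices.1 hτ
    have h3 := hX.degree_add h2.1
    have h4 := hle τ hτ
    -- Degree, size and number of gaps add up to `n`, so at fixed size most gaps means least degree.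
    omega
  have hgap' : Z.spectralGap k = (n : ℝ) - (d + 1) * f := hgap.csInf_eq
  have hdeg' : Z.minDegree k = Z.degree σ := hdeg.csInf_eq
  have hdeg'' : (Z.minDegree k : ℤ) = n - (k + 1) - f := by
    have := hX.degree_add hσ
    rw [hV] at this
    rw [hdeg']
    omega
  have hfloor : ⌊((k : ℝ) + 1) / (d : ℝ)⌋ = ((m / d : ℕ) : ℤ) := by
    have : (k : ℝ) + 1 = (m : ℝ) := by exact_mod_cast hm.symm
    rw [this, ← Int.natCast_floor_eq_floor (by positivity), Nat.floor_div_eq_div]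
  have hnR : (n : ℝ) = d * t + t + r := by exact_mod_cast hn'
  have hlow : k ≤ (d : ℤ) * t - 1 → f = m / d := fun h => by
    rw [hf]
    refine min_eq_right (Nat.div_le_of_le_mul ?_)
    zify
    omega
  have hhigh : (d : ℤ) * t ≤ k → f = t := fun h => by
    rw [hf]
    refine min_eq_left ((Nat.le_div_iff_mul_le hd).2 ?_)
    rw [mul_comm]
    zify
    omega
  refine ⟨hgap' ▸ hgap, hdeg' ▸ hdeg, fun h => ?_, fun h => ?_, fun h => ?_, fun h => ?_, ?_⟩
  · rw [hgap', hfloor, hlow h, hnR, Int.cast_natCast]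
    ring
  · rw [hgap', hhigh h, hnR]
    ring
  · rw [hdeg'', hfloor, hlow h]
  · rw [hdeg'', hhigh h]
  · have : (Z.minDegree k : ℝ) = n - (k + 1) - f := by exact_mod_cast hdeg''
    rw [hgap', this]
    ring
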